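/- **Theorem 2.5.** Let $(a_n)_{n\ge1}$ and $(b_n)_{n\ge1}$ be real sequences with $a_n\neq0$ for all $n\ge 1$ (for instance $a_n>0$) and $\sup_{n\ge1}(|a_n|+|b_n|)<\infty$. Let $J$ be the corresponding infinite Jacobi matrix, that is, the bounded self-adjoint operator on $\ell^2(\{1,2,\dots\})$ given by $$(Ju)_n=a_nu_{n+1}+b_nu_n+a_{n-1}u_{n-1},\qquad n\ge1,\quad u_0:=0 .$$ For real $E$ define $u_n(E)$ by $u_0(E)=0$, $u_1(E)=1$ and $a_nu_{n+1}(E)+(b_n-E)u_n(E)+a_{n-1}u_{n-1}(E)=0$ for $n\ge1$, and let $P_n(E)=(a_1\cdots a_n)\,u_{n+1}(E)$ for $n\ge0$ (a monic polynomial of degree $n$ in $E$, with $P_0=1$). Put $\operatorname{sgn}(x)=1$ for $x\ge0$ and $\operatorname{sgn}(x)=-1$ for $x<0$. Let $P_S(J)$ denote the spectral projection of $J$ onto a Borel set $S\subset\mathbb R$. Then for every real $E_0$ $$\dim\operatorname{ran}P_{(E_0,\infty)}(J)=\#\{\ell=1,2,\dots\mid\operatorname{sgn}P_{\ell-1}(E_0)\ne\operatorname{sgn}P_\ell(E_0)\},$$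 $$\dim\operatorname{ran}P_{(-\infty,E_0)}(J)=\#\{\ell=1,2,\dots\mid\operatorname{sgn}P_{\ell-1}(E_0)=\operatorname{sgn}P_\ell(E_0)\},$$ as equalities in $\{0,1,2,\dots\}\cup\{\infty\}$. -/

import Mathlib

noncomputable section

open MeasureTheory Filter Topology
open scoped InnerProductSpace CompactlySupported

/-! ### Spectral projections of a bounded self-adjoint operator -/

section SpectralProjection

variable {H : Type*} [NormedAddCommGroup H] [InnerProductSpace ℂ H] [CompleteSpace H]

/-- The positive linear functional `f ↦ ⟨f(A) x, x⟩` on continuous functions on the (compact)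
spectrum of `A`, where `f(A)` is the continuous functional calculus. -/
def spectralFunctional (A : H →L[ℂ] H) (hA : IsSelfAdjoint A) (x : H) :
    C_c(spectrum ℝ A, ℝ) →ₚ[ℝ] ℝ where
  toFun f := (⟪cfcHom (R := ℝ) hA f.toContinuousMap x, x⟫_ℂ).re
  map_add' f g := by
    have h : (f + g).toContinuousMap = f.toContinuousMap + g.toContinuousMap := rfl
    simp [h]
  map_smul' c f := by
    have h : (c • f).toContinuousMap = c • f.toContinuousMap := rfl
    have h2 : cfcHom (R := ℝ) hA (c • f.toContinuousMap)
        = c • cfcHom (R := ℝ) hA f.toContinuousMap := map_smul _ _ _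
    have h3 : ((c • cfcHom (R := ℝ) hA f.toContinuousMap) x)
        = (c : ℂ) • (cfcHom (R := ℝ) hA f.toContinuousMap x) := by
      simp
    rw [h, h2, h3, inner_smul_left]
    simp
  monotone' f g hfg := by
    have h1 : cfcHom (R := ℝ) hA f.toContinuousMap ≤ cfcHom (R := ℝ) hA g.toContinuousMap :=
      (cfcHom_le_iff hA).2 hfg
    have h2 := ((ContinuousLinearMap.le_def _ _).1 h1).re_inner_nonneg_left x
    simp only [sub_apply, inner_sub_left, map_sub] at h2
    have h3 := sub_nonneg.1 h2
    exact h3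

/-- The spectral measure of `A` at the vector `x`, as a measure on the spectrum: the measure
representing `f ↦ ⟨f(A) x, x⟩`. -/
def spectralMeasureOnSpectrum (A : H →L[ℂ] H) (hA : IsSelfAdjoint A) (x : H) :
    Measure (spectrum ℝ A) :=
  RealRMK.rieszMeasure (spectralFunctional A hA x)

/-- The spectral measure of `A` at the vector `x`, as a measure on `ℝ`. -/
def spectralMeasure (A : H →L[ℂ] H) (hA : IsSelfAdjoint A) (x : H) : Measure ℝ :=
  (spectralMeasureOnSpectrum A hA x).map Subtype.val

instance isFiniteMeasure_spectralMeasureOnSpectrum (A : H →L[ℂ] H) (hA : IsSelfAdjoint A) (x : H) :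
    IsFiniteMeasure (spectralMeasureOnSpectrum A hA x) := by
  have : IsFiniteMeasureOnCompacts (spectralMeasureOnSpectrum A hA x) := by
    unfold spectralMeasureOnSpectrum RealRMK.rieszMeasure
    infer_instance
  infer_instance

lemma integral_spectralMeasureOnSpectrum (A : H →L[ℂ] H) (hA : IsSelfAdjoint A) (x : H)
    (f : C(spectrum ℝ A, ℝ)) :
    ∫ t, f t ∂(spectralMeasureOnSpectrum A hA x) = (⟪cfcHom (R := ℝ) hA f x, x⟫_ℂ).re :=
  RealRMK.integral_rieszMeasure (spectralFunctional A hA x)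
    (CompactlySupportedContinuousMap.continuousMapEquiv f)

lemma inner_cfcHom_self (A : H →L[ℂ] H) (hA : IsSelfAdjoint A) (x : H)
    (f : C(spectrum ℝ A, ℝ)) :
    ⟪cfcHom (R := ℝ) hA f x, x⟫_ℂ
      = ((∫ t, f t ∂(spectralMeasureOnSpectrum A hA x) : ℝ) : ℂ) := by
  rw [integral_spectralMeasureOnSpectrum]
  have h : IsSelfAdjoint (cfcHom (R := ℝ) hA f) := cfcHom_predicate hA f
  have h2 := (ContinuousLinearMap.isSelfAdjoint_iff_isSymmetric.1 h)
  exact (LinearMap.IsSymmetric.coe_re_inner_apply_self h2 x).symm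

/-- A pointwise limit of the quadratic forms of bounded operators, if real, is the quadratic form
of a bounded operator. -/
lemma exists_clm_of_tendsto_form (T : ℕ → H →L[ℂ] H) (q : H → ℝ)
    (h : ∀ x, Tendsto (fun n => ⟪T n x, x⟫_ℂ) atTop (𝓝 (q x : ℂ))) :
    ∃ S : H →L[ℂ] H, ∀ x, ⟪S x, x⟫_ℂ = (q x : ℂ) := by
  have hlim : ∀ x y, ∃ c : ℂ, Tendsto (fun n => ⟪T n x, y⟫_ℂ) atTop (𝓝 c) := by
    intro x y
    have h1 := ((((h (y + x)).sub (h (y - x))).add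
      ((h (y + Complex.I • x)).const_mul Complex.I)).sub
      ((h (y - Complex.I • x)).const_mul Complex.I)).div_const 4
    exact ⟨_, h1.congr fun n => (inner_map_polarization (T n).toLinearMap y x).symm⟩
  choose B hB using hlim
  have hrep : ∀ x, ∃ z : H, ∀ y, ⟪z, y⟫_ℂ = B x y := by
    intro x
    let g : H →L[ℂ] ℂ := continuousLinearMapOfTendsto (fun n => innerSL ℂ (T n x))
      (f := fun y => B x y) (tendsto_pi_nhds.2 fun y => by simpa using hB x y)
    exact ⟨(InnerProductSpace.toDual ℂ H).symm g, fun y => by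
      rw [InnerProductSpace.toDual_symm_apply]; rfl⟩
  choose S hS using hrep
  let L : H →ₗ[ℂ] H :=
    { toFun := S
      map_add' := fun x y => by
        refine ext_inner_right ℂ fun v => ?_
        rw [inner_add_left, hS, hS, hS]
        refine tendsto_nhds_unique (hB _ _) ?_
        simpa [inner_add_left] using (hB x v).add (hB y v)
      map_smul' := fun c x => by
        refine ext_inner_right ℂ fun v => ?_
        rw [RingHom.id_apply, inner_smul_left, hS, hS]
        refine tendsto_nhds_unique (hB _ _) ?_
        simpa [inner_smul_left, mul_comm] using (hB x v).const_mul ((starRingEnd ℂ) c) }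
  have hL : ∀ x, ⟪L x, x⟫_ℂ = (q x : ℂ) := fun x =>
    (hS x x).trans (tendsto_nhds_unique (hB x x) (h x))
  have hsym : L.IsSymmetric := by
    rw [LinearMap.isSymmetric_iff_inner_map_self_real]
    intro v
    rw [hL v, Complex.conj_ofReal]
  exact ⟨⟨L, hsym.continuous⟩, hL⟩

lemma exists_spectralProjection_aux (A : H →L[ℂ] H) (hA : IsSelfAdjoint A)
    (S : Set (spectrum ℝ A)) (hS : MeasurableSet S) :
    ∃ P : H →L[ℂ] H, ∀ x,
      ⟪P x, x⟫_ℂ = (((spectralMeasureOnSpectrum A hA x).real S : ℝ) : ℂ) := by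
  refine MeasurableSpace.induction_on_inter
    (C := fun S _ => ∃ P : H →L[ℂ] H, ∀ x,
      ⟪P x, x⟫_ℂ = (((spectralMeasureOnSpectrum A hA x).real S : ℝ) : ℂ))
    (BorelSpace.measurable_eq.trans borel_eq_generateFrom_isClosed) isPiSystem_isClosed
    ?_ ?_ ?_ ?_ S hS
  · exact ⟨0, fun x => by simp⟩
  · intro F hF
    replace hF : IsClosed F := hF
    let f : ℕ → C(spectrum ℝ A, ℝ) := fun n =>
      ⟨fun t => (hF.apprSeq n t : ℝ), by fun_prop⟩
    refine exists_clm_of_tendsto_form (fun n => cfcHom (R := ℝ) hA (f n)) _ fun x => ?_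
    simp_rw [inner_cfcHom_self]
    refine (Complex.continuous_ofReal.tendsto _).comp ?_
    have hind : (spectralMeasureOnSpectrum A hA x).real F
        = ∫ t, F.indicator (fun _ => (1 : ℝ)) t ∂(spectralMeasureOnSpectrum A hA x) := by
      rw [integral_indicator hF.measurableSet]; simp
    rw [hind]
    refine tendsto_integral_of_dominated_convergence (fun _ => (1 : ℝ)) ?_ ?_ ?_ ?_
    · exact fun n => (f n).continuous.aestronglyMeasurable
    · exact integrable_const _
    · intro n
      refine Eventually.of_forall fun t => ?_
      have := HasOuterApproxClosed.apprSeq_apply_le_one hF n t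
      simpa [f] using this
    · refine Eventually.of_forall fun t => ?_
      have h1 := (tendsto_pi_nhds.1 (HasOuterApproxClosed.tendsto_apprSeq hF)) t
      have h2 := (NNReal.continuous_coe.tendsto _).comp h1
      have h3 : F.indicator (fun _ => (1 : ℝ)) t
          = ((F.indicator (fun _ => (1 : NNReal)) t : NNReal) : ℝ) := by
        by_cases ht : t ∈ F <;> simp [ht]
      rw [h3]
      exact h2
  · intro S hS ih
    obtain ⟨P, hP⟩ := ih
    refine ⟨1 - P, fun x => ?_⟩
    have h1 := inner_cfcHom_self A hA x 1
    have h2 : ∫ t, (1 : C(spectrum ℝ A, ℝ)) t ∂(spectralMeasureOnSpectrum A hA x)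
        = (spectralMeasureOnSpectrum A hA x).real Set.univ := by simp
    rw [h2, map_one] at h1
    rw [sub_apply, inner_sub_left, h1, hP, measureReal_compl hS]
    push_cast
    rfl
  · intro S hd hS ih
    choose P hP using ih
    refine exists_clm_of_tendsto_form (fun n => ∑ i ∈ Finset.range n, P i) _ fun x => ?_
    have h1 : ∀ n, ⟪(∑ i ∈ Finset.range n, P i) x, x⟫_ℂ
        = ((∑ i ∈ Finset.range n, (spectralMeasureOnSpectrum A hA x).real (S i) : ℝ) : ℂ) := by
      intro n
      rw [sum_apply, sum_inner]
      push_cast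
      exact Finset.sum_congr rfl fun i _ => hP i x
    simp_rw [h1]
    refine (Complex.continuous_ofReal.tendsto _).comp ?_
    have h2 : HasSum (fun i => (spectralMeasureOnSpectrum A hA x).real (S i))
        ((spectralMeasureOnSpectrum A hA x).real (⋃ i, S i)) := by
      simp only [measureReal_def]
      rw [measure_iUnion hd hS, ENNReal.tsum_toReal_eq fun i => measure_ne_top _ _]
      refine ENNReal.hasSum_toReal ?_
      rw [← measure_iUnion hd hS]
      exact measure_ne_top _ _
    exact h2.tendsto_sum_nat

lemma exists_spectralProjection (A : H →L[ℂ] H) (hA : IsSelfAdjoint A)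
    (S : Set ℝ) (hS : MeasurableSet S) :
    ∃ P : H →L[ℂ] H, ∀ x, ⟪P x, x⟫_ℂ = (((spectralMeasure A hA x).real S : ℝ) : ℂ) := by
  obtain ⟨P, hP⟩ := exists_spectralProjection_aux A hA _ (measurable_subtype_coe hS)
  refine ⟨P, fun x => ?_⟩
  rw [hP, spectralMeasure, measureReal_def, measureReal_def,
    Measure.map_apply measurable_subtype_coe hS]

/-- The spectral projection `P_S(A)` of a bounded self-adjoint operator `A` onto a Borel set `S`:
the (unique) bounded operator with `⟨P_S(A) x, x⟩ = μ_x(S)` for all `x`, where `μ_x` is the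
spectral measure of `A` at `x`. -/
def spectralProjection (A : H →L[ℂ] H) (hA : IsSelfAdjoint A) (S : Set ℝ)
    (hS : MeasurableSet S) : H →L[ℂ] H :=
  (exists_spectralProjection A hA S hS).choose

lemma inner_spectralProjection (A : H →L[ℂ] H) (hA : IsSelfAdjoint A) (S : Set ℝ)
    (hS : MeasurableSet S) (x : H) :
    ⟪spectralProjection A hA S hS x, x⟫_ℂ = (((spectralMeasure A hA x).real S : ℝ) : ℂ) :=
  (exists_spectralProjection A hA S hS).choose_spec x

lemma eq_spectralProjection (A : H →L[ℂ] H) (hA : IsSelfAdjoint A) (S : Set ℝ)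
    (hS : MeasurableSet S) (P : H →L[ℂ] H)
    (hP : ∀ x, ⟪P x, x⟫_ℂ = (((spectralMeasure A hA x).real S : ℝ) : ℂ)) :
    P = spectralProjection A hA S hS := by
  refine ContinuousLinearMap.coe_inj.1 ((ext_inner_map _ _).1 fun x => ?_)
  exact (hP x).trans (inner_spectralProjection A hA S hS x).symm

end SpectralProjection

/-! ### Infinite Jacobi matrices

The parameters are `a 1, a 2, …` and `b 1, b 2, …`; the values `a 0`, `b 0` play no role. -/

/-- The Hilbert space `ℓ²`; the coordinate `u k`, `k = 0, 1, …`, is the `(k+1)`-st coordinate in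
the indexing in which Jacobi matrices have rows and columns `1, 2, …`. -/
abbrev EllTwo : Type := lp (fun _ : ℕ => ℂ) 2

/-- Boundedness of the Jacobi parameters, `sup_{n ≥ 1} (|a n| + |b n|) < ∞`. -/
def JacobiBounded (a b : ℕ → ℝ) : Prop :=
  ∃ C : ℝ, ∀ n, 1 ≤ n → |a n| + |b n| ≤ C

/-- Multiplication of a column vector by the tridiagonal matrix with diagonal `b 1, b 2, …`
and off-diagonals `a 1, a 2, …`. -/
def jacobiAction (a b : ℕ → ℝ) (u : ℕ → ℂ) : ℕ → ℂ
  | 0 => b 1 * u 0 + a 1 * u 1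
  | n + 1 => a (n + 1) * u n + b (n + 2) * u (n + 1) + a (n + 2) * u (n + 2)

lemma ellTwo_summable (u : EllTwo) : Summable fun n => ‖u n‖ ^ 2 := by
  have := (lp.memℓp u).summable (by norm_num)
  simpa using this

lemma memℓp_jacobiAction {a b : ℕ → ℝ} (h : JacobiBounded a b) (u : EllTwo) :
    Memℓp (E := fun _ : ℕ => ℂ) (jacobiAction a b u) 2 := by
  obtain ⟨C, hC⟩ := h
  refine memℓp_gen ?_
  simp only [ENNReal.toReal_ofNat, Real.rpow_ofNat]
  refine (summable_nat_add_iff 1).1 ?_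
  have hs := ellTwo_summable u
  have h1 := (summable_nat_add_iff 1).2 hs
  have h2 := (summable_nat_add_iff 2).2 hs
  refine Summable.of_nonneg_of_le (fun n => by positivity) (fun n => ?_)
    (((hs.add h1).add h2).mul_left (3 * C ^ 2))
  have ha1 : |a (n + 1)| ≤ C := by
    have := hC (n + 1) (by omega); have := abs_nonneg (b (n + 1)); linarith
  have ha2 : |a (n + 2)| ≤ C := by
    have := hC (n + 2) (by omega); have := abs_nonneg (b (n + 2)); linarith
  have hb2 : |b (n + 2)| ≤ C := by
    have := hC (n + 2) (by omega); have := abs_nonneg (a (n + 2)); linarith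
  have hC0 : 0 ≤ C := (abs_nonneg _).trans ha1
  have hn : ‖jacobiAction a b u (n + 1)‖ ≤ C * ‖u n‖ + C * ‖u (n + 1)‖ + C * ‖u (n + 2)‖ := by
    simp only [jacobiAction]
    refine (norm_add₃_le).trans ?_
    simp only [norm_mul, Complex.norm_real, Real.norm_eq_abs]
    gcongr
  calc ‖jacobiAction a b u (n + 1)‖ ^ 2
      ≤ (C * ‖u n‖ + C * ‖u (n + 1)‖ + C * ‖u (n + 2)‖) ^ 2 := by gcongr
    _ = C ^ 2 * (‖u n‖ + ‖u (n + 1)‖ + ‖u (n + 2)‖) ^ 2 := by ring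
    _ ≤ C ^ 2 * (3 * (‖u n‖ ^ 2 + ‖u (n + 1)‖ ^ 2 + ‖u (n + 2)‖ ^ 2)) := by
        gcongr
        nlinarith [sq_nonneg (‖u n‖ - ‖u (n + 1)‖), sq_nonneg (‖u n‖ - ‖u (n + 2)‖),
          sq_nonneg (‖u (n + 1)‖ - ‖u (n + 2)‖)]
    _ = 3 * C ^ 2 * (‖u n‖ ^ 2 + ‖u (n + 1)‖ ^ 2 + ‖u (n + 2)‖ ^ 2) := by ring

/-- The Jacobi matrix as an everywhere defined linear map on `ℓ²`. -/
def jacobiLinearMap (a b : ℕ → ℝ) (h : JacobiBounded a b) : EllTwo →ₗ[ℂ] EllTwo where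
  toFun u := ⟨jacobiAction a b u, memℓp_jacobiAction h u⟩
  map_add' u v := by
    ext n
    change jacobiAction a b (u + v : EllTwo) n = jacobiAction a b u n + jacobiAction a b v n
    cases n <;> simp [jacobiAction] <;> ring
  map_smul' c u := by
    ext n
    change jacobiAction a b (c • u : EllTwo) n = c * jacobiAction a b u n
    cases n <;> simp [jacobiAction] <;> ring

lemma jacobiLinearMap_isSymmetric (a b : ℕ → ℝ) (h : JacobiBounded a b) :
    (jacobiLinearMap a b h).IsSymmetric := by
  intro u v
  have hu := lp.hasSum_inner (𝕜 := ℂ) (jacobiLinearMap a b h u) v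
  have hv := lp.hasSum_inner (𝕜 := ℂ) u (jacobiLinearMap a b h v)
  have hlim := (hu.sub hv).tendsto_sum_nat
  have hw : ∀ N : ℕ, ∑ k ∈ Finset.range (N + 1),
      (⟪jacobiLinearMap a b h u k, v k⟫_ℂ - ⟪u k, jacobiLinearMap a b h v k⟫_ℂ)
      = (a (N + 1) : ℂ) * (starRingEnd ℂ (u (N + 1)) * v N - starRingEnd ℂ (u N) * v (N + 1)) := by
    intro N
    induction N with
    | zero => simp [jacobiLinearMap, jacobiAction]; ring
    | succ N ih =>
      rw [Finset.sum_range_succ, ih]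
      simp [jacobiLinearMap, jacobiAction]
      ring
  have hzero : ∀ w : EllTwo, Tendsto (fun n => w n) atTop (𝓝 0) := by
    intro w
    have h1 := (ellTwo_summable w).tendsto_atTop_zero
    have h2 := h1.sqrt
    rw [tendsto_zero_iff_norm_tendsto_zero]
    simpa using h2
  have h0 : Tendsto (fun N : ℕ => (a (N + 1) : ℂ) *
      (starRingEnd ℂ (u (N + 1)) * v N - starRingEnd ℂ (u N) * v (N + 1))) atTop (𝓝 0) := by
    obtain ⟨C, hC⟩ := h
    have hu0 := (Complex.continuous_conj.tendsto 0).comp (hzero u)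
    rw [map_zero] at hu0
    have hu1 := hu0.comp (tendsto_add_atTop_nat 1)
    have hv1 := (hzero v).comp (tendsto_add_atTop_nat 1)
    have hd := (hu1.mul (hzero v)).sub (hu0.mul hv1)
    rw [mul_zero, sub_zero] at hd
    refine isBoundedUnder_le_mul_tendsto_zero
      (isBoundedUnder_of_eventually_le (a := C) (Eventually.of_forall fun n => ?_)) hd
    have := hC (n + 1) (by omega)
    have := abs_nonneg (b (n + 1))
    rw [Function.comp_apply, Complex.norm_real, Real.norm_eq_abs]
    linarith
  have h1 := hlim.comp (tendsto_add_atTop_nat 1)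
  have h2 : Tendsto (fun N : ℕ => (a (N + 1) : ℂ) *
      (starRingEnd ℂ (u (N + 1)) * v N - starRingEnd ℂ (u N) * v (N + 1))) atTop
      (𝓝 (⟪jacobiLinearMap a b h u, v⟫_ℂ - ⟪u, jacobiLinearMap a b h v⟫_ℂ)) :=
    h1.congr fun N => hw N
  exact sub_eq_zero.1 (tendsto_nhds_unique h2 h0)

/-- The bounded infinite Jacobi matrix with parameters `a`, `b`, as a bounded operator on `ℓ²`. -/
def jacobiOperator (a b : ℕ → ℝ) (h : JacobiBounded a b) : EllTwo →L[ℂ] EllTwo :=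
  ⟨jacobiLinearMap a b h, (jacobiLinearMap_isSymmetric a b h).continuous⟩

lemma jacobiOperator_isSelfAdjoint (a b : ℕ → ℝ) (h : JacobiBounded a b) :
    IsSelfAdjoint (jacobiOperator a b h) :=
  ContinuousLinearMap.isSelfAdjoint_iff_isSymmetric.2 (jacobiLinearMap_isSymmetric a b h)

/-- The fundamental solution of `a n * u (n+1) + (b n - E) * u n + a (n-1) * u (n-1) = 0`,
`n = 1, 2, …`, with `u 0 = 0` and `u 1 = 1`. -/
def fundamentalSolution (a b : ℕ → ℝ) (E : ℝ) : ℕ → ℝ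
  | 0 => 0
  | 1 => 1
  | n + 2 => (a (n + 1))⁻¹ * (E - b (n + 1)) * fundamentalSolution a b E (n + 1)
      - (a (n + 1))⁻¹ * a n * fundamentalSolution a b E n

/-- The polynomial `p_n(E) = u_{n+1}(E)`, of degree `n` in `E`. -/
def jacobiPoly (a b : ℕ → ℝ) (n : ℕ) (E : ℝ) : ℝ :=
  fundamentalSolution a b E (n + 1)

/-- The monic polynomial `P_n(E) = (a_1 ⋯ a_n) p_n(E)`. -/
def monicJacobiPoly (a b : ℕ → ℝ) (n : ℕ) (E : ℝ) : ℝ :=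
  (∏ k ∈ Finset.Icc 1 n, a k) * jacobiPoly a b n E

/-- The sign, with the convention `sgn 0 = 1`. -/
def sgn (x : ℝ) : ℤ := if 0 ≤ x then 1 else -1

/-- The dimension of a linear subspace, as a natural number or `∞`. (For a closed subspace of
`ℓ²` this is the Hilbert space dimension, with `∞` for countably infinite.) -/
def subspaceDim {V : Type*} [AddCommGroup V] [Module ℂ V] (W : Submodule ℂ V) : ℕ∞ :=
  Cardinal.toENat (Module.rank ℂ W)

end

/-!
Write `T = J - E`. The projection of `J` onto `(E, ∞)` has a range on which the quadratic form of
`T` is positive definite and a kernel on which it is nonpositive. Hence the dimension of its range is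
the index of the form, and it can be counted in any family with dense span in which the form is
diagonal (`subspaceDim_range_eq_encard`). For `(-∞, E)` the same holds with `-T`.

Such a family comes from the fundamental solution. Let `F_k` be its truncation to the coordinates
`u_1, …, u_{k+1}`. As `u` solves the difference equation, `T F_k` lives on the two coordinates next to
the cut (`shiftedJacobi_truncatedSolution`), which makes the `F_k` mutually orthogonal for the form,
with the value `-a_{k+1} u_{k+1} u_{k+2}` at `F_k`. Up to a positive factor this is `-P_k P_{k+1}`, so
positive values correspond to sign changes. At a zero of `u` two consecutive truncations coincide and
are isotropic; they are replaced by a basis of a hyperbolic plane, with one positive and one negative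
value, in accordance with the one sign change and the one equality of signs which the convention
`sgn 0 = 1` produces around a zero of `P` (`signChange_succ_of_eq_zero`).

The spectral projection is specified only through `⟨P x, x⟩ = μ_x(S)`. The sign of the form on its
kernel is immediate from that; on its range it requires `P P = P` (`spectralProjection_idem`).
-/

noncomputable section
open MeasureTheory Filter Topology
open scoped InnerProductSpace CompactlySupported


/-! ### The index of a quadratic form in a diagonalizing family -/

section Inertia

variable {H : Type*} [NormedAddCommGroup H] [InnerProductSpace ℂ H]

lemma inner_apply_linearCombination {T : H →L[ℂ] H} {v : ℕ → H} {q : ℕ → ℝ}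
    (hq : ∀ i j, ⟪v i, T (v j)⟫_ℂ = if i = j then (q i : ℂ) else 0) (c : ℕ →₀ ℂ) (i : ℕ) :
    ⟪v i, T (Finsupp.linearCombination ℂ v c)⟫_ℂ = c i * q i := by
  rw [Finsupp.linearCombination_apply, Finsupp.sum, map_sum, inner_sum]
  simp only [map_smul, inner_smul_right, hq, mul_ite, mul_zero]
  simp +contextual

lemma re_inner_linearCombination_self {T : H →L[ℂ] H} {v : ℕ → H} {q : ℕ → ℝ}
    (hq : ∀ i j, ⟪v i, T (v j)⟫_ℂ = if i = j then (q i : ℂ) else 0) (c : ℕ →₀ ℂ) :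
    (⟪Finsupp.linearCombination ℂ v c, T (Finsupp.linearCombination ℂ v c)⟫_ℂ).re
      = ∑ i ∈ c.support, ‖c i‖ ^ 2 * q i := by
  conv_lhs => rw [Finsupp.linearCombination_apply, Finsupp.sum, sum_inner,
    ← Finsupp.sum.eq_1 c (fun i z => z • v i), ← Finsupp.linearCombination_apply]
  rw [Complex.re_sum]
  refine Finset.sum_congr rfl fun i _ => ?_
  rw [inner_smul_left, inner_apply_linearCombination hq, ← mul_assoc, Complex.conj_mul']
  norm_cast

/-- A form that is diagonal in a family with dense span is bounded above by its positive part; this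
passes from the span to all vectors by continuity since the positive part is a finite sum. -/
lemma re_inner_self_le_sum {T : H →L[ℂ] H} {v : ℕ → H} {q : ℕ → ℝ}
    (hq : ∀ i j, ⟪v i, T (v j)⟫_ℂ = if i = j then (q i : ℂ) else 0)
    (hv : Dense (Submodule.span ℂ (Set.range v) : Set H)) (s : Finset ℕ)
    (hs : ∀ i, i ∈ s ↔ 0 < q i) (x : H) :
    (⟪x, T x⟫_ℂ).re ≤ ∑ i ∈ s, ‖⟪v i, T x⟫_ℂ‖ ^ 2 / q i := by
  refine hv.induction (P := fun x => (⟪x, T x⟫_ℂ).re ≤ ∑ i ∈ s, ‖⟪v i, T x⟫_ℂ‖ ^ 2 / q i)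
    ?_ ?_ x
  · intro x hx
    obtain ⟨c, rfl⟩ := (Finsupp.mem_span_range_iff_exists_finsupp).1 hx
    rw [← Finsupp.linearCombination_apply, re_inner_linearCombination_self hq]
    have h1 : ∀ i ∈ s, ‖⟪v i, T (Finsupp.linearCombination ℂ v c)⟫_ℂ‖ ^ 2 / q i
        = ‖c i‖ ^ 2 * q i := by
      intro i hi
      have := (hs i).1 hi
      rw [inner_apply_linearCombination hq, norm_mul, Complex.norm_real, Real.norm_eq_abs,
        mul_pow, sq_abs]
      field_simp
    rw [Finset.sum_congr rfl h1, ← Finset.sum_filter_add_sum_filter_not c.support (· ∈ s)]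
    have h2 : ∑ i ∈ c.support with i ∉ s, ‖c i‖ ^ 2 * q i ≤ 0 :=
      Finset.sum_nonpos fun i hi => mul_nonpos_of_nonneg_of_nonpos (by positivity)
        (not_lt.1 fun h => (Finset.mem_filter.1 hi).2 ((hs i).2 h))
    have h3 : ∑ i ∈ c.support with i ∈ s, ‖c i‖ ^ 2 * q i ≤ ∑ i ∈ s, ‖c i‖ ^ 2 * q i :=
      Finset.sum_le_sum_of_subset_of_nonneg (fun i hi => (Finset.mem_filter.1 hi).2)
        fun i hi _ => by have := (hs i).1 hi; positivity
    linarith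
  · refine isClosed_le ?_ ?_
    · exact Complex.continuous_re.comp (continuous_id.inner T.continuous)
    · exact continuous_finsetSum _ fun i _ =>
        (((continuous_const.inner T.continuous).norm.pow 2).div_const _)

/-- Sylvester's law of inertia, with the index realized as the dimension of the range of an operator
`P`. Here `P` stands for the spectral projection of `T` onto `(0, ∞)`, and only the signs of the form
of `T` on the range and on the kernel of `P` matter. -/
theorem subspaceDim_range_eq_encard {T P : H →L[ℂ] H} {v : ℕ → H} {q : ℕ → ℝ}
    (hq : ∀ i j, ⟪v i, T (v j)⟫_ℂ = if i = j then (q i : ℂ) else 0)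
    (hv : Dense (Submodule.span ℂ (Set.range v) : Set H))
    (hpos : ∀ w ∈ LinearMap.range P.toLinearMap, w ≠ 0 → 0 < (⟪w, T w⟫_ℂ).re)
    (hneg : ∀ x, P x = 0 → (⟪x, T x⟫_ℂ).re ≤ 0) :
    subspaceDim (LinearMap.range P.toLinearMap) = Set.encard {i | 0 < q i} := by
  refine le_antisymm ?_ ?_
  · rcases Set.finite_or_infinite {i | 0 < q i} with hfin | hinf
    -- A vector of the range orthogonal to all `T v i` with `0 < q i` has a nonpositive form, so
    -- these finitely many functionals separate the points of the range.
    · let s := hfin.toFinset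
      have hs : ∀ i, i ∈ s ↔ 0 < q i := fun i => by simp [s]
      let f : H →ₗ[ℂ] (s → ℂ) := LinearMap.pi fun i => (innerSL ℂ (v i)).toLinearMap ∘ₗ T.toLinearMap
      have hf : Function.Injective (f.domRestrict (LinearMap.range P.toLinearMap)) := by
        rw [injective_iff_map_eq_zero]
        rintro ⟨w, hw⟩ hfw
        by_contra hne
        have h0 : w ≠ 0 := fun h => hne (Subtype.ext h)
        have h1 := hpos w hw h0
        have h2 := re_inner_self_le_sum hq hv s hs w
        rw [Finset.sum_eq_zero] at h2
        · linarith
        · intro i hi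
          have h3 : ⟪v i, T w⟫_ℂ = 0 := congrFun hfw ⟨i, hi⟩
          simp [h3]
      have h := LinearMap.lift_rank_le_of_injective _ hf
      rw [rank_fun', Fintype.card_coe] at h
      have h' := OrderHomClass.mono Cardinal.toENat h
      rw [hfin.encard_eq_coe_toFinset_card]
      simpa [subspaceDim, s] using h'
    · rw [hinf.encard_eq]
      exact le_top
  -- The form is positive on the span of the `v i` with `0 < q i`, so that `P` is injective there.
  · let w : {i | 0 < q i} → LinearMap.range P.toLinearMap := fun i => ⟨P (v i), ⟨v i, rfl⟩⟩
    have hw : LinearIndependent ℂ w := by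
      have h1 : LinearIndependent ℂ (fun i : {i | 0 < q i} => P (v i)) := by
        have h2 : LinearIndepOn ℂ (fun i => P (v i)) {i | 0 < q i} := by
          rw [linearIndepOn_iff]
          intro c hc h0
          have h3 : P (Finsupp.linearCombination ℂ v c) = 0 := by
            rw [← h0, Finsupp.linearCombination_apply, Finsupp.linearCombination_apply,
              Finsupp.sum, Finsupp.sum, map_sum]
            simp
          have h4 := hneg _ h3
          rw [re_inner_linearCombination_self hq] at h4
          have h5 : ∀ i ∈ c.support, 0 < q i := fun i hi => (Finsupp.mem_supported _ _).1 hc hi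
          have h6 : ∀ i ∈ c.support, 0 ≤ ‖c i‖ ^ 2 * q i := fun i hi => by
            have := h5 i hi; positivity
          have h7 := (Finset.sum_eq_zero_iff_of_nonneg h6).1
            (le_antisymm h4 (Finset.sum_nonneg h6))
          ext i
          by_contra hi
          have hi' : i ∈ c.support := Finsupp.mem_support_iff.2 hi
          have h8 : ‖c i‖ ^ 2 * q i = 0 := h7 i hi'
          have h9 : 0 < ‖c i‖ ^ 2 * q i := mul_pos (by have := norm_pos_iff.2 hi; positivity) (h5 i hi')
          linarith
        exact h2
      exact LinearIndependent.of_comp (LinearMap.range P.toLinearMap).subtype h1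
    have h := OrderHomClass.mono Cardinal.toENat hw.cardinal_lift_le_rank
    rw [Cardinal.toENat_lift, Cardinal.toENat_lift] at h
    exact h

end Inertia

/-! ### Continuous functional calculus and spectral projections -/

section Spectral

variable {H : Type*} [NormedAddCommGroup H] [InnerProductSpace ℂ H]

/-- By polarization, convergence of the quadratic forms is weak operator convergence. -/
lemma tendsto_inner_of_tendsto_inner_self {T : ℕ → H →L[ℂ] H} {S : H →L[ℂ] H}
    (h : ∀ x, Tendsto (fun n => ⟪T n x, x⟫_ℂ) atTop (𝓝 ⟪S x, x⟫_ℂ)) (x y : H) :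
    Tendsto (fun n => ⟪T n x, y⟫_ℂ) atTop (𝓝 ⟪S x, y⟫_ℂ) := by
  have h1 := ((((h (y + x)).sub (h (y - x))).add
      ((h (y + Complex.I • x)).const_mul Complex.I)).sub
      ((h (y - Complex.I • x)).const_mul Complex.I)).div_const 4
  have h2 := h1.congr fun n => (inner_map_polarization (T n).toLinearMap y x).symm
  have h3 := inner_map_polarization S.toLinearMap y x
  simp only [ContinuousLinearMap.coe_coe] at h2 h3
  rwa [← h3] at h2

variable [CompleteSpace H]

/-- The operator `g(A)`, for a self-adjoint `A` and a continuous `g` on the whole line. -/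
def continuousFunctionOf (A : H →L[ℂ] H) (hA : IsSelfAdjoint A) (g : C(ℝ, ℝ)) : H →L[ℂ] H :=
  cfcHom (R := ℝ) hA (g.restrict (spectrum ℝ A))

variable (A : H →L[ℂ] H) (hA : IsSelfAdjoint A)

instance isFiniteMeasure_spectralMeasure (x : H) : IsFiniteMeasure (spectralMeasure A hA x) := by
  unfold spectralMeasure; infer_instance

lemma inner_continuousFunctionOf (g : C(ℝ, ℝ)) (x : H) :
    ⟪continuousFunctionOf A hA g x, x⟫_ℂ = ((∫ t, g t ∂(spectralMeasure A hA x) : ℝ) : ℂ) := by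
  rw [continuousFunctionOf, inner_cfcHom_self, spectralMeasure,
    integral_map measurable_subtype_coe.aemeasurable g.continuous.aestronglyMeasurable]
  rfl

lemma integrable_spectralMeasure (g : C(ℝ, ℝ)) (x : H) :
    Integrable g (spectralMeasure A hA x) := by
  rw [spectralMeasure, integrable_map_measure g.continuous.aestronglyMeasurable
    measurable_subtype_coe.aemeasurable]
  have hc : Continuous (g ∘ (Subtype.val : spectrum ℝ A → ℝ)) :=
    g.continuous.comp continuous_subtype_val
  exact (hc.integrable_of_hasCompactSupport (HasCompactSupport.of_compactSpace _))

lemma spectralMeasure_univ (x : H) :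
    (((spectralMeasure A hA x).real Set.univ : ℝ) : ℂ) = ⟪x, x⟫_ℂ := by
  have h := inner_continuousFunctionOf A hA 1 x
  have h1 : continuousFunctionOf A hA 1 = 1 := map_one (cfcHom (R := ℝ) hA)
  rw [h1] at h
  rw [one_apply_eq_self] at h
  rw [h]; simp

/-- The indicator function of an open set is a bounded pointwise limit of continuous functions that
vanish off the set. -/
lemma exists_approx_indicator {U : Set ℝ} (hU : IsOpen U) :
    ∃ f : ℕ → C(ℝ, ℝ), (∀ n t, ‖f n t‖ ≤ 1) ∧ (∀ n, ∀ t ∉ U, f n t = 0) ∧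
      ∀ t ∈ U, Tendsto (fun n => f n t) atTop (𝓝 1) := by
  have hF : IsClosed Uᶜ := hU.isClosed_compl
  refine ⟨fun n => ⟨fun t => 1 - (hF.apprSeq n t : ℝ), by fun_prop⟩, ?_, ?_, ?_⟩
  · intro n t
    have h1 : hF.apprSeq n t ≤ 1 := HasOuterApproxClosed.apprSeq_apply_le_one hF n t
    have h2 : (hF.apprSeq n t : ℝ) ≤ 1 := by exact_mod_cast h1
    have h3 : (0 : ℝ) ≤ hF.apprSeq n t := NNReal.coe_nonneg _
    simp only [ContinuousMap.coe_mk, Real.norm_eq_abs, abs_le]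
    constructor <;> linarith
  · intro n t ht
    have h1 : hF.apprSeq n t = 1 := HasOuterApproxClosed.apprSeq_apply_eq_one hF n ht
    simp [h1]
  · intro t ht
    have h1 := (tendsto_pi_nhds.1 (HasOuterApproxClosed.tendsto_apprSeq hF)) t
    have h2 := (NNReal.continuous_coe.tendsto _).comp h1
    have h3 := h2.const_sub 1
    simpa [ht] using h3

lemma tendsto_inner_mul_continuousFunctionOf {U : Set ℝ} {f : ℕ → C(ℝ, ℝ)}
    (h1 : ∀ n t, ‖f n t‖ ≤ 1) (h0 : ∀ n, ∀ t ∉ U, f n t = 0)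
    (hf : ∀ t ∈ U, Tendsto (fun n => f n t) atTop (𝓝 1)) (g : C(ℝ, ℝ)) (x : H) :
    Tendsto (fun n => ⟪continuousFunctionOf A hA (f n * g) x, x⟫_ℂ) atTop
      (𝓝 ((∫ t, U.indicator g t ∂(spectralMeasure A hA x) : ℝ) : ℂ)) := by
  simp_rw [inner_continuousFunctionOf]
  refine (Complex.continuous_ofReal.tendsto _).comp ?_
  refine tendsto_integral_of_dominated_convergence (fun t => ‖g t‖) ?_ ?_ ?_ ?_
  · exact fun n => (f n * g).continuous.aestronglyMeasurable
  · exact (integrable_spectralMeasure A hA g x).norm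
  · intro n
    refine Eventually.of_forall fun t => ?_
    rw [ContinuousMap.mul_apply, norm_mul]
    exact mul_le_of_le_one_left (norm_nonneg _) (h1 n t)
  · refine Eventually.of_forall fun t => ?_
    by_cases ht : t ∈ U
    · simpa [ht] using (hf t ht).mul_const (g t)
    · simp [ht, h0 _ t ht]

/-- The operator characterized by `⟨P x, x⟩ = μ_x(U)` is idempotent when `U` is open. If `f n` are
continuous, vanish off `U` and tend boundedly to its indicator function, then `f n (A) → P` weakly,
and `f n * f m → f m` gives `P f m (A) = f m (A)`; letting `m → ∞` gives `P P = P`. -/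
lemma spectralProjection_idem {U : Set ℝ} (hU : IsOpen U) (x : H) :
    spectralProjection A hA U hU.measurableSet (spectralProjection A hA U hU.measurableSet x)
      = spectralProjection A hA U hU.measurableSet x := by
  obtain ⟨f, h1, h0, hf⟩ := exists_approx_indicator hU
  set P := spectralProjection A hA U hU.measurableSet with hP
  have hweak : ∀ x y, Tendsto (fun n => ⟪continuousFunctionOf A hA (f n) x, y⟫_ℂ) atTop
      (𝓝 ⟪P x, y⟫_ℂ) := by
    refine tendsto_inner_of_tendsto_inner_self fun x => ?_
    have h := tendsto_inner_mul_continuousFunctionOf A hA h1 h0 hf 1 x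
    rw [integral_indicator hU.measurableSet] at h
    simpa [hP, inner_spectralProjection, measureReal_def] using h
  have hmul : ∀ m x, P (continuousFunctionOf A hA (f m) x) = continuousFunctionOf A hA (f m) x := by
    intro m x
    refine ext_inner_right ℂ fun y => ?_
    have hw := tendsto_inner_of_tendsto_inner_self
      (T := fun n => continuousFunctionOf A hA (f n * f m)) (S := continuousFunctionOf A hA (f m))
      (fun x => by
        have h := tendsto_inner_mul_continuousFunctionOf A hA h1 h0 hf (f m) x
        have h2 : U.indicator (f m) = f m := Set.indicator_eq_self.2 fun t ht => by
          by_contra h3; exact ht (h0 m t h3)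
        rwa [h2, ← inner_continuousFunctionOf] at h) x y
    refine tendsto_nhds_unique (hweak _ y) (hw.congr fun n => ?_)
    have h3 : continuousFunctionOf A hA (f n * f m)
        = continuousFunctionOf A hA (f n) * continuousFunctionOf A hA (f m) :=
      map_mul (cfcHom (R := ℝ) hA) ((f n).restrict (spectrum ℝ A))
        ((f m).restrict (spectrum ℝ A))
    rw [h3]; rfl
  refine ext_inner_right ℂ fun y => ?_
  have h4 := hweak x (ContinuousLinearMap.adjoint P y)
  simp only [ContinuousLinearMap.adjoint_inner_right, hmul] at h4
  exact tendsto_nhds_unique h4 (hweak x y)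

lemma re_inner_nonpos_of_spectralProjection_eq_zero (g : C(ℝ, ℝ)) {U : Set ℝ}
    (hU : MeasurableSet U) (hg : ∀ t ∉ U, g t ≤ 0) {x : H}
    (hx : spectralProjection A hA U hU x = 0) :
    (⟪x, continuousFunctionOf A hA g x⟫_ℂ).re ≤ 0 := by
  have h1 := inner_spectralProjection A hA U hU x
  rw [hx, inner_zero_left] at h1
  have h2 : (spectralMeasure A hA x).real U = 0 := by exact_mod_cast h1.symm
  rw [measureReal_eq_zero_iff] at h2
  rw [← inner_conj_symm, inner_continuousFunctionOf, Complex.conj_re, Complex.ofReal_re]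
  refine integral_nonpos_of_ae ?_
  filter_upwards [measure_eq_zero_iff_ae_notMem.1 h2] with t ht
  exact hg t ht

/-- For `w` in the range, idempotence gives `μ_w(U) = ‖w‖²`, so that `μ_w` is carried by `U`. -/
lemma re_inner_pos_of_mem_range_spectralProjection (g : C(ℝ, ℝ)) {U : Set ℝ}
    (hU : IsOpen U) (hg : ∀ t ∈ U, 0 < g t) {w : H}
    (hw : w ∈ LinearMap.range (spectralProjection A hA U hU.measurableSet).toLinearMap)
    (hne : w ≠ 0) :
    0 < (⟪w, continuousFunctionOf A hA g w⟫_ℂ).re := by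
  obtain ⟨y, rfl⟩ := hw
  have h1 := spectralProjection_idem A hA hU y
  set w := spectralProjection A hA U hU.measurableSet y
  change w ≠ 0 at hne
  change 0 < (⟪w, continuousFunctionOf A hA g w⟫_ℂ).re
  have h2 := inner_spectralProjection A hA U hU.measurableSet w
  rw [h1, ← spectralMeasure_univ A hA] at h2
  have h3 : (spectralMeasure A hA w).real Uᶜ = 0 := by
    rw [measureReal_compl hU.measurableSet, sub_eq_zero]
    exact_mod_cast h2
  rw [measureReal_eq_zero_iff] at h3
  have h4 : ∀ᵐ t ∂(spectralMeasure A hA w), 0 < g t := by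
    filter_upwards [measure_eq_zero_iff_ae_notMem.1 h3] with t ht
    exact hg t (not_not.1 ht)
  rw [← inner_conj_symm, inner_continuousFunctionOf, Complex.conj_re, Complex.ofReal_re]
  have h5 : ∀ᵐ t ∂(spectralMeasure A hA w), 0 ≤ g t := h4.mono fun _ => le_of_lt
  refine lt_of_le_of_ne (integral_nonneg_of_ae h5) fun h6 => hne ?_
  have h7 := (integral_eq_zero_iff_of_nonneg_ae h5 (integrable_spectralMeasure A hA g w)).1 h6.symm
  have h8 : ∀ᵐ t ∂(spectralMeasure A hA w), False := by
    filter_upwards [h4, h7] with t ht ht'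
    exact ht.ne' ht'
  have h9 : spectralMeasure A hA w = 0 := by
    rwa [eventually_false_iff_eq_bot, ae_eq_bot] at h8
  have h10 := spectralMeasure_univ A hA w
  rw [h9] at h10
  simpa using h10.symm

end Spectral

/-! ### Sign changes of the orthogonal polynomials -/

section SignChanges

variable (a b : ℕ → ℝ) (E : ℝ)

/-- `1` if the sequence `P_0(E), P_1(E), …` changes sign between the indices `k` and `k + 1`,
otherwise `-1`. -/
def signChange (k : ℕ) : ℝ :=
  if sgn (monicJacobiPoly a b k E) ≠ sgn (monicJacobiPoly a b (k + 1) E) then 1 else -1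

variable {a b E}

lemma fundamentalSolution_recurrence (ha : ∀ n, 1 ≤ n → a n ≠ 0) (n : ℕ) :
    a (n + 1) * fundamentalSolution a b E (n + 2)
      = (E - b (n + 1)) * fundamentalSolution a b E (n + 1) - a n * fundamentalSolution a b E n := by
  have := ha (n + 1) (by omega)
  rw [fundamentalSolution]
  field_simp

lemma fundamentalSolution_ne_zero_of_succ_eq_zero (ha : ∀ n, 1 ≤ n → a n ≠ 0) (n : ℕ)
    (h : fundamentalSolution a b E (n + 2) = 0) : fundamentalSolution a b E (n + 1) ≠ 0 := by
  induction n with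
  | zero => simp [fundamentalSolution]
  | succ n ih =>
    intro h0
    have h1 := fundamentalSolution_recurrence (b := b) (E := E) ha (n + 1)
    rw [h, h0] at h1
    have h2 : a (n + 1) * fundamentalSolution a b E (n + 1) = 0 := by linarith
    exact ih h0 ((mul_eq_zero.1 h2).resolve_left (ha _ (by omega)))

lemma monicJacobiPoly_succ (k : ℕ) :
    monicJacobiPoly a b (k + 1) E
      = (∏ j ∈ Finset.Icc 1 k, a j) * (a (k + 1) * fundamentalSolution a b E (k + 2)) := by
  rw [monicJacobiPoly, jacobiPoly, Finset.prod_Icc_succ_top (by omega), mul_assoc]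

lemma prod_Icc_ne_zero (ha : ∀ n, 1 ≤ n → a n ≠ 0) (k : ℕ) : ∏ j ∈ Finset.Icc 1 k, a j ≠ 0 :=
  Finset.prod_ne_zero_iff.2 fun j hj => ha j (Finset.mem_Icc.1 hj).1

lemma sgn_ne_sgn_iff {x y : ℝ} (hx : x ≠ 0) (hy : y ≠ 0) : sgn x ≠ sgn y ↔ x * y < 0 := by
  rw [mul_neg_iff]
  unfold sgn
  rcases hx.lt_or_gt with hx | hx <;> rcases hy.lt_or_gt with hy | hy <;>
    simp [hx, hy, hx.le, hy.le, hx.not_ge, hy.not_ge, hx.not_gt, hy.not_gt]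

lemma sgn_monicJacobiPoly_ne_iff (ha : ∀ n, 1 ≤ n → a n ≠ 0) {k : ℕ}
    (h1 : fundamentalSolution a b E (k + 1) ≠ 0) (h2 : fundamentalSolution a b E (k + 2) ≠ 0) :
    sgn (monicJacobiPoly a b k E) ≠ sgn (monicJacobiPoly a b (k + 1) E)
      ↔ a (k + 1) * fundamentalSolution a b E (k + 1) * fundamentalSolution a b E (k + 2) < 0 := by
  have hp := prod_Icc_ne_zero ha k
  have hak := ha (k + 1) (by omega)
  rw [sgn_ne_sgn_iff (show monicJacobiPoly a b k E ≠ 0 from mul_ne_zero hp h1)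
    (by rw [monicJacobiPoly_succ]; exact mul_ne_zero hp (mul_ne_zero hak h2)),
    monicJacobiPoly_succ]
  have h3 : monicJacobiPoly a b k E *
      ((∏ j ∈ Finset.Icc 1 k, a j) * (a (k + 1) * fundamentalSolution a b E (k + 2)))
      = (∏ j ∈ Finset.Icc 1 k, a j) ^ 2 *
        (a (k + 1) * fundamentalSolution a b E (k + 1) * fundamentalSolution a b E (k + 2)) := by
    rw [monicJacobiPoly, jacobiPoly]
    ring
  rw [h3, mul_neg_iff]
  have h4 : 0 < (∏ j ∈ Finset.Icc 1 k, a j) ^ 2 := by positivity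
  simp [h4, h4.not_gt]

/-- At a zero `P_{k+1}(E) = 0` the neighbours `P_k(E)` and `P_{k+2}(E)` have opposite signs, so that
exactly one of the two steps is a sign change. -/
lemma signChange_succ_of_eq_zero (ha : ∀ n, 1 ≤ n → a n ≠ 0) {k : ℕ}
    (h : fundamentalSolution a b E (k + 2) = 0) :
    signChange a b E (k + 1) = -signChange a b E k := by
  have h1 : monicJacobiPoly a b (k + 1) E = 0 := by rw [monicJacobiPoly_succ, h]; simp
  have h0 : monicJacobiPoly a b k E ≠ 0 :=
    mul_ne_zero (prod_Icc_ne_zero ha k) (fundamentalSolution_ne_zero_of_succ_eq_zero ha k h)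
  have h2 : monicJacobiPoly a b (k + 2) E = -(a (k + 1) ^ 2 * monicJacobiPoly a b k E) := by
    rw [monicJacobiPoly_succ, fundamentalSolution_recurrence ha, h,
      Finset.prod_Icc_succ_top (by omega), monicJacobiPoly, jacobiPoly]
    ring
  have h3 : 0 < a (k + 1) ^ 2 := by have := ha (k + 1) (by omega); positivity
  unfold signChange
  rw [h1, h2]
  rcases h0.lt_or_gt with h4 | h4
  · have h5 : 0 ≤ -(a (k + 1) ^ 2 * monicJacobiPoly a b k E) := by nlinarith
    simp [sgn, h4.not_ge, h5]
  · have h5 : ¬ 0 ≤ -(a (k + 1) ^ 2 * monicJacobiPoly a b k E) := by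
      have := mul_pos h3 h4; linarith
    simp [sgn, h4.le, h5]

end SignChanges

/-! ### A basis diagonalizing the form of `J - E` -/

section Basis

lemma inner_eq_zero_of_forall {x y : EllTwo} (h : ∀ n, x n = 0 ∨ y n = 0) : ⟪x, y⟫_ℂ = 0 := by
  rw [lp.inner_eq_tsum]
  refine (tsum_congr fun n => ?_).trans tsum_zero
  rcases h n with h | h <;> simp [h]

lemma ellTwo_add_apply (x y : EllTwo) (n : ℕ) : (x + y) n = x n + y n := rfl

lemma ellTwo_smul_apply (c : ℂ) (x : EllTwo) (n : ℕ) : (c • x) n = c * x n := rfl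

/-- The standard basis vector of `ℓ²` with coordinate `1` at `k`. -/
def ellTwoSingle (k : ℕ) : EllTwo := lp.single 2 k (1 : ℂ)

lemma ellTwoSingle_apply (k n : ℕ) : ellTwoSingle k n = if n = k then 1 else 0 := by
  rw [ellTwoSingle, lp.single_apply, Pi.single_apply]

lemma inner_ellTwoSingle (x : EllTwo) (k : ℕ) : ⟪x, ellTwoSingle k⟫_ℂ = starRingEnd ℂ (x k) := by
  rw [ellTwoSingle, lp.inner_single_right]
  simp

lemma dense_span_ellTwoSingle :
    Dense (Submodule.span ℂ (Set.range ellTwoSingle) : Set EllTwo) := by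
  intro x
  refine mem_closure_of_tendsto (lp.hasSum_single (by simp) x) (Eventually.of_forall fun s => ?_)
  refine Submodule.sum_mem _ fun i _ => ?_
  have h : lp.single 2 i (x i) = x i • ellTwoSingle i := by
    rw [ellTwoSingle, ← lp.single_smul]; simp
  rw [h]
  exact Submodule.smul_mem _ _ (Submodule.subset_span ⟨i, rfl⟩)

variable (a b : ℕ → ℝ) (hab : JacobiBounded a b) (E : ℝ)

/-- The operator `J - E`. -/
def shiftedJacobi : EllTwo →L[ℂ] EllTwo := jacobiOperator a b hab - (E : ℂ) • 1

lemma inner_shiftedJacobi (x y : EllTwo) :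
    ⟪shiftedJacobi a b hab E x, y⟫_ℂ = ⟪x, shiftedJacobi a b hab E y⟫_ℂ := by
  have h := jacobiLinearMap_isSymmetric a b hab x y
  change ⟪jacobiLinearMap a b hab x - (E : ℂ) • x, y⟫_ℂ
    = ⟪x, jacobiLinearMap a b hab y - (E : ℂ) • y⟫_ℂ
  rw [inner_sub_left, inner_sub_right, h, inner_smul_left, inner_smul_right, Complex.conj_ofReal]

lemma shiftedJacobi_apply (x : EllTwo) (n : ℕ) :
    shiftedJacobi a b hab E x n = jacobiAction a b x n - E * x n := rfl

lemma shiftedJacobi_single_zero :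
    shiftedJacobi a b hab E (ellTwoSingle 0)
      = ((b 1 - E : ℝ) : ℂ) • ellTwoSingle 0 + (a 1 : ℂ) • ellTwoSingle 1 := by
  ext n
  rw [shiftedJacobi_apply]
  simp only [ellTwo_add_apply, ellTwo_smul_apply, ellTwoSingle_apply]
  rcases n with _ | _ | n <;> simp [jacobiAction, ellTwoSingle_apply]

lemma shiftedJacobi_single_succ (k : ℕ) :
    shiftedJacobi a b hab E (ellTwoSingle (k + 1))
      = (a (k + 1) : ℂ) • ellTwoSingle k + ((b (k + 2) - E : ℝ) : ℂ) • ellTwoSingle (k + 1)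
        + (a (k + 2) : ℂ) • ellTwoSingle (k + 2) := by
  ext n
  rw [shiftedJacobi_apply]
  rcases n with _ | n
  · simp only [jacobiAction, ellTwo_add_apply, ellTwo_smul_apply, ellTwoSingle_apply]
    rcases k with _ | k <;> simp
  · simp only [jacobiAction, ellTwo_add_apply, ellTwo_smul_apply, ellTwoSingle_apply]
    rcases lt_trichotomy n k with h | rfl | h
    · by_cases h' : n + 1 = k
      · subst h'; simp [show n ≠ n + 1 + 1 by omega]
      · simp [h', show n ≠ k + 1 by omega, show n ≠ k by omega]
    · simp
    · by_cases h' : n = k + 1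
      · subst h'; simp [show k + 1 + 1 ≠ k by omega]
      · simp [h', show n ≠ k by omega, show n + 1 ≠ k by omega]

/-- The truncation `(u_1(E), …, u_{k+1}(E), 0, 0, …)` of the fundamental solution. -/
def truncatedSolution (k : ℕ) : EllTwo :=
  ∑ j ∈ Finset.range (k + 1), (fundamentalSolution a b E (j + 1) : ℂ) • ellTwoSingle j

lemma truncatedSolution_succ (k : ℕ) :
    truncatedSolution a b E (k + 1) = truncatedSolution a b E k
      + (fundamentalSolution a b E (k + 2) : ℂ) • ellTwoSingle (k + 1) := by
  rw [truncatedSolution, Finset.sum_range_succ]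
  rfl

lemma truncatedSolution_apply (k n : ℕ) :
    truncatedSolution a b E k n = if n ≤ k then (fundamentalSolution a b E (n + 1) : ℂ) else 0 := by
  induction k with
  | zero =>
    rw [truncatedSolution, Finset.sum_range_one, ellTwo_smul_apply, ellTwoSingle_apply]
    by_cases h : n = 0 <;> simp [h]
  | succ k ih =>
    rw [truncatedSolution_succ]
    simp only [ellTwo_add_apply, ellTwo_smul_apply, ih, ellTwoSingle_apply]
    rcases lt_trichotomy n (k + 1) with h | rfl | h
    · simp [show n ≤ k by omega, show n ≤ k + 1 by omega, h.ne]
    · simp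
    · simp [show ¬ n ≤ k by omega, show ¬ n ≤ k + 1 by omega, h.ne']

variable {a}

/-- The truncation solves `(J - E) u = 0` except in the two coordinates next to the cut. -/
lemma shiftedJacobi_truncatedSolution (ha : ∀ n, 1 ≤ n → a n ≠ 0) (k : ℕ) :
    shiftedJacobi a b hab E (truncatedSolution a b E k)
      = ((-(a (k + 1) * fundamentalSolution a b E (k + 2)) : ℝ) : ℂ) • ellTwoSingle k
        + ((a (k + 1) * fundamentalSolution a b E (k + 1) : ℝ) : ℂ) • ellTwoSingle (k + 1) := by
  induction k with
  | zero =>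
    have h := fundamentalSolution_recurrence (b := b) (E := E) ha 0
    have h1 : truncatedSolution a b E 0 = ellTwoSingle 0 := by
      rw [truncatedSolution, Finset.sum_range_one, fundamentalSolution, Complex.ofReal_one, one_smul]
    rw [h1, shiftedJacobi_single_zero, h]
    simp [fundamentalSolution]
  | succ k ih =>
    rw [truncatedSolution_succ, map_add, map_smul, ih, shiftedJacobi_single_succ,
      fundamentalSolution_recurrence ha (k + 1)]
    push_cast
    module

/-- A vector `e_{k+1} + s F_k`, with `F_k` the `k`-th truncated solution. When `u_{k+2}(E) = 0`, the
vector `F_k` is isotropic for the form of `J - E` but pairs nontrivially with `e_{k+1}`, and `s` is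
chosen so that the form takes the value `r` at this vector. The vectors for `r` and `-r` are
orthogonal for the form. -/
def hyperbolicVector (a b : ℕ → ℝ) (E : ℝ) (k : ℕ) (r : ℝ) : EllTwo :=
  ellTwoSingle (k + 1) + (((r - (b (k + 2) - E)) /
    (2 * (a (k + 1) * fundamentalSolution a b E (k + 1))) : ℝ) : ℂ) • truncatedSolution a b E k

lemma hyperbolicVector_apply_eq_zero (r : ℝ) {k n : ℕ} (hn : k + 1 < n) :
    hyperbolicVector a b E k r n = 0 := by
  simp only [hyperbolicVector, ellTwo_add_apply, ellTwo_smul_apply, ellTwoSingle_apply,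
    truncatedSolution_apply]
  simp [show n ≠ k + 1 by omega, show ¬ n ≤ k by omega]

variable {b} {E}

lemma shiftedJacobi_hyperbolicVector (ha : ∀ n, 1 ≤ n → a n ≠ 0) {k : ℕ}
    (h : fundamentalSolution a b E (k + 2) = 0) (r : ℝ) :
    shiftedJacobi a b hab E (hyperbolicVector a b E k r)
      = (a (k + 1) : ℂ) • ellTwoSingle k + (((r + (b (k + 2) - E)) / 2 : ℝ) : ℂ) • ellTwoSingle (k + 1)
        + (a (k + 2) : ℂ) • ellTwoSingle (k + 2) := by
  have h1 := fundamentalSolution_ne_zero_of_succ_eq_zero ha k h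
  have h2 := ha (k + 1) (by omega)
  rw [hyperbolicVector, map_add, map_smul, shiftedJacobi_single_succ,
    shiftedJacobi_truncatedSolution _ _ _ ha, h, mul_zero, neg_zero, Complex.ofReal_zero, zero_smul,
    zero_add, smul_smul, ← Complex.ofReal_mul, div_mul_eq_mul_div,
    mul_div_mul_right _ _ (mul_ne_zero h2 h1)]
  push_cast
  module

lemma inner_hyperbolicVector (ha : ∀ n, 1 ≤ n → a n ≠ 0) {k : ℕ}
    (h : fundamentalSolution a b E (k + 2) = 0) (r s : ℝ) :
    ⟪hyperbolicVector a b E k r, shiftedJacobi a b hab E (hyperbolicVector a b E k s)⟫_ℂ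
      = (((r + s) / 2 : ℝ) : ℂ) := by
  have h1 := fundamentalSolution_ne_zero_of_succ_eq_zero ha k h
  have h2 := ha (k + 1) (by omega)
  rw [shiftedJacobi_hyperbolicVector hab ha h, inner_add_right, inner_add_right, inner_smul_right,
    inner_smul_right, inner_smul_right, inner_ellTwoSingle, inner_ellTwoSingle, inner_ellTwoSingle,
    hyperbolicVector_apply_eq_zero b E r (show k + 1 < k + 2 by omega)]
  simp only [hyperbolicVector, ellTwo_add_apply, ellTwo_smul_apply, ellTwoSingle_apply,
    truncatedSolution_apply]
  simp only [show k ≠ k + 1 by omega, le_refl, if_true, if_false, show ¬ k + 1 ≤ k by omega,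
    zero_add, mul_zero, add_zero, map_mul, map_one, map_zero, Complex.conj_ofReal, mul_one]
  norm_cast
  field_simp
  ring

variable (a b E)

/-- The family in which the form of `J - E` is diagonal: the `k`-th truncated solution, unless
`u_{k+1}(E)` or `u_{k+2}(E)` vanishes. At a zero `u_{m+2}(E) = 0` the `m`-th and `(m+1)`-st truncated
solutions coincide, and the vectors with indices `m` and `m + 1` are instead taken from the hyperbolic
plane spanned by this solution and `e_{m+1}`, the form having the values `1` and `-1` there in the
order given by the sign changes. -/
def diagonalVector (k : ℕ) : EllTwo :=
  if fundamentalSolution a b E (k + 2) = 0 then hyperbolicVector a b E k (signChange a b E k)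
  else if fundamentalSolution a b E (k + 1) = 0 then
    hyperbolicVector a b E (k - 1) (signChange a b E k)
  else truncatedSolution a b E k

/-- The diagonal entries of the form of `J - E` in the family `diagonalVector`. -/
def diagonalValue (k : ℕ) : ℝ :=
  if fundamentalSolution a b E (k + 2) = 0 ∨ fundamentalSolution a b E (k + 1) = 0 then
    signChange a b E k
  else -(a (k + 1) * fundamentalSolution a b E (k + 1) * fundamentalSolution a b E (k + 2))

variable {a b E}

lemma diagonalVector_of_eq_zero {k : ℕ} (h : fundamentalSolution a b E (k + 2) = 0) :
    diagonalVector a b E k = hyperbolicVector a b E k (signChange a b E k) := if_pos h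

lemma diagonalVector_succ_of_eq_zero (ha : ∀ n, 1 ≤ n → a n ≠ 0) {k : ℕ}
    (h : fundamentalSolution a b E (k + 2) = 0) :
    diagonalVector a b E (k + 1) = hyperbolicVector a b E k (-signChange a b E k) := by
  have h1 : fundamentalSolution a b E (k + 3) ≠ 0 := fun h1 =>
    fundamentalSolution_ne_zero_of_succ_eq_zero ha (k + 1) h1 h
  rw [diagonalVector, if_neg h1, if_pos h, signChange_succ_of_eq_zero ha h, Nat.add_sub_cancel]

lemma diagonalVector_of_ne_zero {k : ℕ} (h1 : fundamentalSolution a b E (k + 1) ≠ 0)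
    (h2 : fundamentalSolution a b E (k + 2) ≠ 0) :
    diagonalVector a b E k = truncatedSolution a b E k := by
  rw [diagonalVector, if_neg h2, if_neg h1]

lemma solution_cases (a b : ℕ → ℝ) (E : ℝ) (k : ℕ) :
    (fundamentalSolution a b E (k + 1) ≠ 0 ∧ fundamentalSolution a b E (k + 2) ≠ 0) ∨
    fundamentalSolution a b E (k + 2) = 0 ∨
    ∃ m, k = m + 1 ∧ fundamentalSolution a b E (m + 2) = 0 := by
  by_cases h2 : fundamentalSolution a b E (k + 2) = 0
  · exact Or.inr (Or.inl h2)
  by_cases h1 : fundamentalSolution a b E (k + 1) = 0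
  · rcases k with _ | m
    · simp [fundamentalSolution] at h1
    · exact Or.inr (Or.inr ⟨m, rfl, h1⟩)
  · exact Or.inl ⟨h1, h2⟩

lemma inner_diagonalVector_self (ha : ∀ n, 1 ≤ n → a n ≠ 0) (k : ℕ) :
    ⟪diagonalVector a b E k, shiftedJacobi a b hab E (diagonalVector a b E k)⟫_ℂ
      = (diagonalValue a b E k : ℂ) := by
  rcases solution_cases a b E k with ⟨h1, h2⟩ | h | ⟨m, rfl, h⟩
  · rw [diagonalVector_of_ne_zero h1 h2, diagonalValue, if_neg (by simp [h1, h2]),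
      shiftedJacobi_truncatedSolution _ _ _ ha, inner_add_right, inner_smul_right,
      inner_smul_right, inner_ellTwoSingle, inner_ellTwoSingle, truncatedSolution_apply,
      truncatedSolution_apply, if_pos le_rfl, if_neg (by omega), map_zero, mul_zero, add_zero,
      Complex.conj_ofReal]
    norm_cast
    ring
  · rw [diagonalVector_of_eq_zero h, diagonalValue, if_pos (Or.inl h),
      inner_hyperbolicVector hab ha h]
    congr 1; ring
  · rw [diagonalVector_succ_of_eq_zero ha h, diagonalValue, if_pos (Or.inr h),
      inner_hyperbolicVector hab ha h, signChange_succ_of_eq_zero ha h]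
    congr 1; ring

/-- The vector with index `k` is supported in `{0, …, k}`, or in `{0, …, k + 1}` if it is the first
of a hyperbolic pair. -/
lemma diagonalVector_apply_eq_zero (ha : ∀ n, 1 ≤ n → a n ≠ 0) {k n : ℕ} (hn : k < n)
    (h : fundamentalSolution a b E (k + 2) = 0 → k + 1 < n) : diagonalVector a b E k n = 0 := by
  rcases solution_cases a b E k with ⟨h1, h2⟩ | h' | ⟨m, rfl, h'⟩
  · rw [diagonalVector_of_ne_zero h1 h2, truncatedSolution_apply, if_neg (by omega)]
  · rw [diagonalVector_of_eq_zero h', hyperbolicVector_apply_eq_zero _ _ _ (h h')]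
  · rw [diagonalVector_succ_of_eq_zero ha h', hyperbolicVector_apply_eq_zero _ _ _ hn]

/-- The image of the vector with index `k` under `J - E` is supported in `{k, k + 1, …}`, or in
`{k - 1, k, …}` if it is the second of a hyperbolic pair. -/
lemma shiftedJacobi_diagonalVector_apply_eq_zero (ha : ∀ n, 1 ≤ n → a n ≠ 0) {k n : ℕ}
    (hn : n < k) (h : fundamentalSolution a b E (k + 1) = 0 → n + 1 < k) :
    shiftedJacobi a b hab E (diagonalVector a b E k) n = 0 := by
  rcases solution_cases a b E k with ⟨h1, h2⟩ | h' | ⟨m, rfl, h'⟩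
  · rw [diagonalVector_of_ne_zero h1 h2, shiftedJacobi_truncatedSolution _ _ _ ha]
    simp only [ellTwo_add_apply, ellTwo_smul_apply, ellTwoSingle_apply]
    simp [show n ≠ k by omega, show n ≠ k + 1 by omega]
  · rw [diagonalVector_of_eq_zero h', shiftedJacobi_hyperbolicVector _ ha h']
    simp only [ellTwo_add_apply, ellTwo_smul_apply, ellTwoSingle_apply]
    simp [show n ≠ k by omega, show n ≠ k + 1 by omega,
      show n ≠ k + 2 by omega]
  · have := h h'
    rw [diagonalVector_succ_of_eq_zero ha h', shiftedJacobi_hyperbolicVector _ ha h']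
    simp only [ellTwo_add_apply, ellTwo_smul_apply, ellTwoSingle_apply]
    simp [show n ≠ m by omega, show n ≠ m + 1 by omega,
      show n ≠ m + 2 by omega]

lemma inner_diagonalVector_of_lt (ha : ∀ n, 1 ≤ n → a n ≠ 0) {i j : ℕ} (hij : i < j) :
    ⟪diagonalVector a b E i, shiftedJacobi a b hab E (diagonalVector a b E j)⟫_ℂ = 0 := by
  by_cases hp : j = i + 1 ∧ fundamentalSolution a b E (i + 2) = 0
  · obtain ⟨rfl, h⟩ := hp
    rw [diagonalVector_of_eq_zero h, diagonalVector_succ_of_eq_zero ha h,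
      inner_hyperbolicVector hab ha h]
    simp
  -- Outside a hyperbolic pair the supports are disjoint: an overlap would require two consecutive
  -- zeros of the fundamental solution.
  · refine inner_eq_zero_of_forall fun n => ?_
    by_contra! hn
    have h1 : n ≤ i ∨ (fundamentalSolution a b E (i + 2) = 0 ∧ n ≤ i + 1) := by
      by_contra! h
      exact hn.1 (diagonalVector_apply_eq_zero ha h.1 h.2)
    have h2 : j ≤ n ∨ (fundamentalSolution a b E (j + 1) = 0 ∧ j ≤ n + 1) := by
      by_contra! h
      exact hn.2 (shiftedJacobi_diagonalVector_apply_eq_zero hab ha h.1 h.2)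
    have h3 : j ≠ i + 1 ∨ fundamentalSolution a b E (i + 2) ≠ 0 := by
      by_contra! h; exact hp h
    rcases h1 with h1 | ⟨h1, h1'⟩ <;> rcases h2 with h2 | ⟨h2, h2'⟩
    · omega
    · obtain rfl : j = i + 1 := by omega
      exact h3.elim (fun h => h rfl) fun h => h h2
    · obtain rfl : j = i + 1 := by omega
      exact h3.elim (fun h => h rfl) fun h => h h1
    · have h4 := h3.resolve_right (not_not.2 h1)
      obtain rfl : j = i + 2 := by omega
      exact fundamentalSolution_ne_zero_of_succ_eq_zero ha (i + 1) h2 h1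

lemma inner_diagonalVector (ha : ∀ n, 1 ≤ n → a n ≠ 0) (i j : ℕ) :
    ⟪diagonalVector a b E i, shiftedJacobi a b hab E (diagonalVector a b E j)⟫_ℂ
      = if i = j then (diagonalValue a b E i : ℂ) else 0 := by
  rcases lt_trichotomy i j with h | rfl | h
  · rw [if_neg h.ne, inner_diagonalVector_of_lt hab ha h]
  · rw [if_pos rfl, inner_diagonalVector_self hab ha]
  · rw [if_neg h.ne', ← inner_shiftedJacobi, ← inner_conj_symm,
      inner_diagonalVector_of_lt hab ha h, map_zero]

lemma truncatedSolution_mem_span {V : Submodule ℂ EllTwo} {k : ℕ}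
    (h : ∀ j ≤ k, ellTwoSingle j ∈ V) : truncatedSolution a b E k ∈ V :=
  V.sum_mem fun j hj => V.smul_mem _ (h j (by simpa [Nat.lt_succ_iff] using hj))

lemma ellTwoSingle_mem_of_truncatedSolution_mem {V : Submodule ℂ EllTwo} {k : ℕ}
    (h : ∀ j < k, ellTwoSingle j ∈ V) (hk : truncatedSolution a b E k ∈ V)
    (hu : fundamentalSolution a b E (k + 1) ≠ 0) : ellTwoSingle k ∈ V := by
  rw [truncatedSolution, Finset.sum_range_succ] at hk
  have h1 := (V.add_mem_iff_right (V.sum_mem fun j hj =>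
    V.smul_mem _ (h j (Finset.mem_range.1 hj)))).1 hk
  exact (V.smul_mem_iff (by exact_mod_cast hu)).1 h1

lemma ellTwoSingle_mem_span_diagonalVector (ha : ∀ n, 1 ≤ n → a n ≠ 0) (k : ℕ) :
    ellTwoSingle k ∈ Submodule.span ℂ (Set.range (diagonalVector a b E)) := by
  have hmem : ∀ j, diagonalVector a b E j ∈ Submodule.span ℂ (Set.range (diagonalVector a b E)) :=
    fun j => Submodule.subset_span ⟨j, rfl⟩
  induction k using Nat.strong_induction_on with
  | _ k ih =>
    rcases solution_cases a b E k with ⟨h1, h2⟩ | h | ⟨m, rfl, h⟩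
    · refine ellTwoSingle_mem_of_truncatedSolution_mem ih ?_ h1
      rw [← diagonalVector_of_ne_zero h1 h2]
      exact hmem k
    · have hu := fundamentalSolution_ne_zero_of_succ_eq_zero ha k h
      have hak := ha (k + 1) (by omega)
      refine ellTwoSingle_mem_of_truncatedSolution_mem ih ?_ hu
      have hs : signChange a b E k ≠ 0 := by unfold signChange; split_ifs <;> norm_num
      have h1 := Submodule.sub_mem _ (hmem k) (hmem (k + 1))
      rw [diagonalVector_of_eq_zero h, diagonalVector_succ_of_eq_zero ha h, hyperbolicVector,
        hyperbolicVector, add_sub_add_left_eq_sub, ← sub_smul, ← Complex.ofReal_sub, ← sub_div] at h1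
      refine (Submodule.smul_mem_iff _ ?_).1 h1
      rw [Complex.ofReal_ne_zero]
      refine div_ne_zero ?_ (by positivity)
      intro h3
      exact hs (by linarith)
    · have h1 := hmem (m + 1)
      rw [diagonalVector_succ_of_eq_zero ha h, hyperbolicVector] at h1
      exact (Submodule.add_mem_iff_left _ (Submodule.smul_mem _ _
        (truncatedSolution_mem_span fun j hj => ih j (by omega)))).1 h1

lemma dense_span_diagonalVector (ha : ∀ n, 1 ≤ n → a n ≠ 0) :
    Dense (Submodule.span ℂ (Set.range (diagonalVector a b E)) : Set EllTwo) := by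
  refine dense_span_ellTwoSingle.mono ?_
  refine SetLike.coe_subset_coe.2 (Submodule.span_le.2 ?_)
  rintro _ ⟨k, rfl⟩
  exact ellTwoSingle_mem_span_diagonalVector ha k

lemma diagonalValue_sign (ha : ∀ n, 1 ≤ n → a n ≠ 0) (k : ℕ) :
    (0 < diagonalValue a b E k ↔
      sgn (monicJacobiPoly a b k E) ≠ sgn (monicJacobiPoly a b (k + 1) E)) ∧
    (0 < -diagonalValue a b E k ↔
      sgn (monicJacobiPoly a b k E) = sgn (monicJacobiPoly a b (k + 1) E)) := by
  by_cases h : fundamentalSolution a b E (k + 2) = 0 ∨ fundamentalSolution a b E (k + 1) = 0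
  · rw [diagonalValue, if_pos h, signChange]
    by_cases hs : sgn (monicJacobiPoly a b k E) = sgn (monicJacobiPoly a b (k + 1) E)
    · simp [hs]
    · simp [hs]
  · rw [diagonalValue, if_neg h, ← not_iff_not (a := 0 < - -_), ← ne_eq]
    push Not at h
    have h0 : a (k + 1) * fundamentalSolution a b E (k + 1) * fundamentalSolution a b E (k + 2)
        ≠ 0 := mul_ne_zero (mul_ne_zero (ha _ (by omega)) h.2) h.1
    rw [sgn_monicJacobiPoly_ne_iff ha h.2 h.1, neg_pos, neg_neg, not_lt]
    exact ⟨Iff.rfl, fun h => lt_of_le_of_ne h h0, le_of_lt⟩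

end Basis

/-! ### Counting eigenvalues by sign changes -/

lemma encard_sign_index (p : ℕ → ℕ → Prop) :
    Set.encard {l : ℕ | 1 ≤ l ∧ p (l - 1) l} = Set.encard {k : ℕ | p k (k + 1)} := by
  rw [← (Nat.succ_injective).encard_image {k : ℕ | p k (k + 1)}]
  congr 1
  ext l
  rcases l with _ | l <;> simp

lemma continuousFunctionOf_id_sub {H : Type*} [NormedAddCommGroup H] [InnerProductSpace ℂ H]
    [CompleteSpace H] (A : H →L[ℂ] H) (hA : IsSelfAdjoint A) (E : ℝ) :
    continuousFunctionOf A hA (ContinuousMap.id ℝ - ContinuousMap.const ℝ E) = A - (E : ℂ) • 1 := by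
  have h1 : (ContinuousMap.id ℝ - ContinuousMap.const ℝ E).restrict (spectrum ℝ A)
      = (ContinuousMap.id ℝ).restrict (spectrum ℝ A)
        - algebraMap ℝ C(spectrum ℝ A, ℝ) E := rfl
  rw [continuousFunctionOf, h1, map_sub, cfcHom_id, AlgHomClass.commutes]
  rfl

lemma continuousFunctionOf_neg {H : Type*} [NormedAddCommGroup H] [InnerProductSpace ℂ H]
    [CompleteSpace H] (A : H →L[ℂ] H) (hA : IsSelfAdjoint A) (g : C(ℝ, ℝ)) :
    continuousFunctionOf A hA (-g) = -continuousFunctionOf A hA g :=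
  map_neg (cfcHom (R := ℝ) hA) (g.restrict (spectrum ℝ A))

theorem theorem2p5 (a b : ℕ → ℝ) (ha : ∀ n, 1 ≤ n → a n ≠ 0) (hab : JacobiBounded a b)
    (E₀ : ℝ) :
    subspaceDim (LinearMap.range (spectralProjection (jacobiOperator a b hab)
        (jacobiOperator_isSelfAdjoint a b hab) (Set.Ioi E₀) measurableSet_Ioi).toLinearMap)
      = Set.encard {l : ℕ | 1 ≤ l ∧
          sgn (monicJacobiPoly a b (l - 1) E₀) ≠ sgn (monicJacobiPoly a b l E₀)} ∧
    subspaceDim (LinearMap.range (spectralProjection (jacobiOperator a b hab)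
        (jacobiOperator_isSelfAdjoint a b hab) (Set.Iio E₀) measurableSet_Iio).toLinearMap)
      = Set.encard {l : ℕ | 1 ≤ l ∧
          sgn (monicJacobiPoly a b (l - 1) E₀) = sgn (monicJacobiPoly a b l E₀)} := by
  have hJ := jacobiOperator_isSelfAdjoint a b hab
  have hT : continuousFunctionOf (jacobiOperator a b hab) hJ
      (ContinuousMap.id ℝ - ContinuousMap.const ℝ E₀) = shiftedJacobi a b hab E₀ :=
    continuousFunctionOf_id_sub _ hJ E₀
  have hT' : continuousFunctionOf (jacobiOperator a b hab) hJ
      (-(ContinuousMap.id ℝ - ContinuousMap.const ℝ E₀)) = -shiftedJacobi a b hab E₀ := by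
    rw [continuousFunctionOf_neg, hT]
  rw [encard_sign_index fun k l =>
      sgn (monicJacobiPoly a b k E₀) ≠ sgn (monicJacobiPoly a b l E₀),
    encard_sign_index fun k l =>
      sgn (monicJacobiPoly a b k E₀) = sgn (monicJacobiPoly a b l E₀)]
  simp_rw [← (diagonalValue_sign (b := b) (E := E₀) ha _).1,
    ← (diagonalValue_sign (b := b) (E := E₀) ha _).2]
  constructor
  · refine subspaceDim_range_eq_encard (T := shiftedJacobi a b hab E₀)
      (inner_diagonalVector hab ha) (dense_span_diagonalVector ha) ?_ ?_
    · intro w hw hne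
      rw [← hT]
      exact re_inner_pos_of_mem_range_spectralProjection _ hJ _ isOpen_Ioi
        (fun t ht => by simpa using ht) hw hne
    · intro x hx
      rw [← hT]
      exact re_inner_nonpos_of_spectralProjection_eq_zero _ hJ _ measurableSet_Ioi
        (fun t ht => by simpa using ht) hx
  · refine subspaceDim_range_eq_encard (T := -shiftedJacobi a b hab E₀)
      (q := fun k => -diagonalValue a b E₀ k)
      (fun i j => ?_) (dense_span_diagonalVector (b := b) (E := E₀) ha) ?_ ?_
    · rw [neg_apply, inner_neg_right, inner_diagonalVector hab ha]
      split_ifs <;> simp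
    · intro w hw hne
      rw [← hT']
      exact re_inner_pos_of_mem_range_spectralProjection _ hJ _ isOpen_Iio
        (fun t ht => by simpa using ht) hw hne
    · intro x hx
      rw [← hT']
      exact re_inner_nonpos_of_spectralProjection_eq_zero _ hJ _ measurableSet_Iio
        (fun t ht => by simpa using ht) hx
end
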